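/- Let $\beta>1$ be a real number. For $x\in[0,1)$ let $T_\beta x=\beta x-\lfloor\beta x\rfloor$, let $\varepsilon_n(x)=\lfloor\beta\,T_\beta^{n-1}x\rfloor$ ($n\ge 1$) be the digits of the $\beta$-expansion of $x$, and let $$\ell_n(x)=\sup\{k\ge 0:\ \varepsilon_{n+1}(x)=\cdots=\varepsilon_{n+k}(x)=0\}\in\{0,1,2,\dots\}\cup\{\infty\}$$ be the length of the longest string of zeros just after the $n$-th digit. Let $\phi$ be a nonnegative real-valued function defined on the positive integers. Then the set $$E_\phi=\{x\in[0,1):\ \ell_n(x)\ge\phi(n)\ \text{for infinitely many } n\}$$ has Hausdorff dimension $$\dim_{\mathrm H}E_\phi=\frac{1}{1+\liminf_{n\to\infty}\phi(n)/n},$$ where the right-hand side is $0$ when $\liminf_{n\to\infty}\phi(n)/n=\infty$. -/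

import Mathlib

open Set Filter Topology
open scoped ENNReal

/-- The `β`-transformation `T_β x = βx - ⌊βx⌋`. -/
noncomputable def betaTransformation (β : ℝ) (x : ℝ) : ℝ := β * x - ⌊β * x⌋

/-- The `n`-th digit `ε_n(x, β) = ⌊β T_β^{n-1} x⌋` of the `β`-expansion of `x`, for `n ≥ 1`.
(Digits are numbered from `1`; the value at `n = 0` is never used.) -/
noncomputable def betaDigit (β : ℝ) (x : ℝ) (n : ℕ) : ℤ :=
  ⌊β * (betaTransformation β)^[n - 1] x⌋

/-- `ℓ_n(x) = sup {k ≥ 0 : ε_{n+1}(x) = ⋯ = ε_{n+k}(x) = 0}`: the length, possibly infinite, of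
the longest string of zeros just after the `n`-th digit of the `β`-expansion of `x`. -/
noncomputable def zeroRunLength (β : ℝ) (n : ℕ) (x : ℝ) : ℕ∞ :=
  ⨆ k ∈ {k : ℕ | ∀ i : ℕ, 1 ≤ i → i ≤ k → betaDigit β x (n + i) = 0}, (k : ℕ∞)

/-- `E_φ = {x ∈ [0,1) : ℓ_n(x) ≥ φ(n) for infinitely many n}`, for nonnegative `φ`. -/
def longZeroRunSet (β : ℝ) (φ : ℕ → ℝ) : Set ℝ :=
  {x | x ∈ Ico (0 : ℝ) 1 ∧
    ∃ᶠ n : ℕ in atTop, ENNReal.ofReal (φ n) ≤ ((zeroRunLength β n x : ℕ∞) : ℝ≥0∞)}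

/-! A run of `k` zeros after digit `n` means `T^n x < β^(-k)`, that is, `x` lies within `β^(-(n+k))`
of the left endpoint of its level-`n` cylinder.

Upper bound: if `φ n ≥ a n` eventually, the set is contained in the upper limit of families of at
most `n β^n + 1` intervals of length `β^(-(1+a)n)` (`exists_finset_cylinder_endpoints`). The sum of
the `s`-th powers of the lengths converges once `s(1+a) > 1`.

Lower bound: full cylinders concatenate freely, and for each `θ < 1` some level `m` has at least
`β^(θ(m+1))` of them (`IsFullCylinder.exists_le_card`). Use them as blocks, each followed by one
zero, but force zero blocks in sparse windows placed at integers `n` with `φ n ≤ a n`. The resulting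
points lie in the set (`mem_longZeroRunSet_of_windows`), while the free blocks keep any prescribed
lower density `σ < 1/(1+a)`. Reading the free blocks as digits in base `M`, the number of blocks, is
an `s`-Hölder map onto `[0,1]`, so the dimension is at least `s` (`le_dimH_range_digitSeries`). -/

/-! ### Zero runs in terms of the orbit -/

theorem betaTransformation_mem_Ico (β x : ℝ) : betaTransformation β x ∈ Ico (0 : ℝ) 1 :=
  ⟨Int.fract_nonneg (β * x), Int.fract_lt_one (β * x)⟩

theorem iterate_betaTransformation_mem_Ico (β : ℝ) {x : ℝ} (hx : x ∈ Ico (0 : ℝ) 1) (n : ℕ) :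
    (betaTransformation β)^[n] x ∈ Ico (0 : ℝ) 1 := by
  cases n with
  | zero => simpa using hx
  | succ n =>
    rw [Function.iterate_succ_apply']
    exact betaTransformation_mem_Ico _ _

theorem betaTransformation_add_int_div {β : ℝ} (hβ : β ≠ 0) {y : ℝ} (hy : y ∈ Ico (0 : ℝ) 1)
    (d : ℤ) : betaTransformation β ((d + y) / β) = y := by
  have h : β * ((d + y) / β) = d + y := by field_simp
  rw [betaTransformation, h, Int.floor_intCast_add, Int.floor_eq_zero_iff.2 hy]
  simp

theorem iterate_betaTransformation_eq_pow_mul {β : ℝ} (hβ : 1 < β) {x : ℝ} (hx : 0 ≤ x) {k : ℕ}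
    (h : β ^ k * x < 1) : (betaTransformation β)^[k] x = β ^ k * x := by
  induction k with
  | zero => simp
  | succ k ih =>
    have h0 : 0 ≤ β ^ (k + 1) * x := by positivity
    have h1 : β ^ k * x ≤ β ^ (k + 1) * x := by gcongr <;> grind
    rw [Function.iterate_succ_apply', ih (h1.trans_lt h), betaTransformation, ← mul_assoc,
      ← pow_succ', Int.floor_eq_zero_iff.2 ⟨h0, h⟩]
    simp

/-- As long as the digits vanish, `T_β` is multiplication by `β`. -/
theorem forall_betaDigit_eq_zero_iff {β : ℝ} (hβ : 1 < β) {x : ℝ} (hx : x ∈ Ico (0 : ℝ) 1)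
    (n k : ℕ) :
    (∀ i : ℕ, 1 ≤ i → i ≤ k → betaDigit β x (n + i) = 0) ↔
      β ^ k * (betaTransformation β)^[n] x < 1 := by
  have hy := iterate_betaTransformation_mem_Ico β hx n
  have key : ∀ j : ℕ, β ^ j * (betaTransformation β)^[n] x < 1 →
      betaDigit β x (n + (j + 1)) = ⌊β ^ (j + 1) * (betaTransformation β)^[n] x⌋ := by
    intro j hj
    rw [betaDigit, show n + (j + 1) - 1 = j + n by lia, Function.iterate_add_apply,
      iterate_betaTransformation_eq_pow_mul hβ hy.1 hj, pow_succ']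
    ring_nf
  constructor
  · intro h
    induction k with
    | zero => simpa using hy.2
    | succ k ih =>
      have h1 := key k (ih fun i h1 h2 => h i h1 (by lia))
      rw [h (k + 1) (by lia) le_rfl] at h1
      exact (Int.floor_eq_zero_iff.1 h1.symm).2
  · intro h i hi hik
    have hle : ∀ j ≤ k, β ^ j * (betaTransformation β)^[n] x < 1 := fun j hj =>
      (mul_le_mul_of_nonneg_right (pow_le_pow_right₀ hβ.le hj) hy.1).trans_lt h
    obtain ⟨j, rfl⟩ := Nat.exists_eq_add_of_le' hi
    rw [key j (hle j (by lia)), Int.floor_eq_zero_iff]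
    have := hy.1
    exact ⟨by positivity, hle _ hik⟩

/-- The supremum may be infinite, but `c` is not: if no admissible integer reaches `c > 0`, all of
them are at most `⌈c⌉₊ - 1 < c`. -/
theorem ofReal_le_zeroRunLength_iff {β : ℝ} (hβ : 1 < β) {x : ℝ} (hx : x ∈ Ico (0 : ℝ) 1)
    (n : ℕ) (c : ℝ) :
    ENNReal.ofReal c ≤ ((zeroRunLength β n x : ℕ∞) : ℝ≥0∞) ↔
      ∃ k : ℕ, c ≤ k ∧ β ^ k * (betaTransformation β)^[n] x < 1 := by
  constructor
  · intro h
    by_contra! hcon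
    have hc : 0 < c := by
      by_contra! hc
      have := hcon 0 (by simpa using hc)
      have := (iterate_betaTransformation_mem_Ico β hx n).2
      simp at *
      linarith
    have hle : zeroRunLength β n x ≤ ((⌈c⌉₊ - 1 : ℕ) : ℕ∞) := by
      refine iSup₂_le fun k hk => ?_
      have hk' := (forall_betaDigit_eq_zero_iff hβ hx n k).1 hk
      have : (k : ℝ) < c := by
        by_contra! hck
        exact (hcon k hck).not_gt hk'
      have := Nat.lt_ceil.2 this
      exact_mod_cast (by lia : k ≤ ⌈c⌉₊ - 1)
    have h1 := h.trans (ENat.toENNReal_le.2 hle)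
    rw [ENat.toENNReal_coe, ENNReal.ofReal_le_natCast] at h1
    have : ⌈c⌉₊ - 1 < ⌈c⌉₊ := by
      have := Nat.ceil_pos.2 hc
      lia
    exact (Nat.lt_ceil.1 this).not_ge h1
  · rintro ⟨k, hck, hk⟩
    have hle : (k : ℕ∞) ≤ zeroRunLength β n x :=
      le_iSup₂_of_le k ((forall_betaDigit_eq_zero_iff hβ hx n k).2 hk) le_rfl
    have := ENat.toENNReal_le.2 hle
    rw [ENat.toENNReal_coe] at this
    exact (ENNReal.ofReal_le_natCast.2 hck).trans this

theorem mem_longZeroRunSet_iff {β : ℝ} (hβ : 1 < β) {φ : ℕ → ℝ} {x : ℝ} :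
    x ∈ longZeroRunSet β φ ↔ x ∈ Ico (0 : ℝ) 1 ∧
      ∃ᶠ n : ℕ in atTop, ∃ k : ℕ, φ n ≤ k ∧ β ^ k * (betaTransformation β)^[n] x < 1 := by
  refine and_congr_right fun hx => ?_
  simp only [ofReal_le_zeroRunLength_iff hβ hx]

/-! ### Upper bound: covering by cylinder endpoints -/

open MeasureTheory Measure in
/-- A set contained in the upper limit of finite families of intervals has dimension at most `s`
when the sum of the `s`-th powers of the lengths converges. -/
theorem dimH_le_of_frequently_mem_Icc {E : Set ℝ} {s : NNReal} (S : ℕ → Finset ℝ) {r : ℕ → ℝ}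
    (hr0 : ∀ n, 0 ≤ r n) (hr : Tendsto r atTop (𝓝 0))
    (hsum : Summable fun n => (S n).card * r n ^ (s : ℝ))
    (hE : ∀ x ∈ E, ∃ᶠ n in atTop, ∃ c ∈ S n, x ∈ Icc c (c + r n)) : dimH E ≤ s := by
  -- `r` need not be monotone, so the mesh of the `N`-th cover is a supremum over the tail.
  let ρ : ℕ → ℝ≥0∞ := fun N => ⨆ n, ENNReal.ofReal (r (n + N))
  have hρ : Tendsto ρ atTop (𝓝 0) := by
    rw [ENNReal.tendsto_atTop_zero]
    intro ε hε
    have h1 : Tendsto (fun n => ENNReal.ofReal (r n)) atTop (𝓝 0) := by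
      simpa using ENNReal.tendsto_ofReal hr
    obtain ⟨N, hN⟩ := (ENNReal.tendsto_atTop_zero.1 h1) ε hε
    exact ⟨N, fun n hn => iSup_le fun k => hN _ (by lia)⟩
  let f : ℕ → ℝ≥0∞ := fun n => (S n).card * ENNReal.ofReal (r n) ^ (s : ℝ)
  have hf : ∑' n, f n ≠ ⊤ := by
    have h1 : ∀ n, f n = ENNReal.ofReal ((S n).card * r n ^ (s : ℝ)) := by
      intro n
      simp only [f]
      rw [ENNReal.ofReal_mul (by positivity), ENNReal.ofReal_natCast,
        ENNReal.ofReal_rpow_of_nonneg (hr0 n) s.coe_nonneg]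
    simp only [h1]
    exact hsum.tsum_ofReal_ne_top
  have hlim := ENNReal.tendsto_sum_nat_add f hf
  have hbound := hausdorffMeasure_le_liminf_tsum (ι := fun N : ℕ => Σ n : ℕ, S (n + N)) (s : ℝ) E
    (l := atTop) ρ hρ (fun N i => Icc (i.2 : ℝ) (i.2 + r (i.1 + N)))
    (Eventually.of_forall fun N i => by
      rw [Real.ediam_Icc]
      exact le_iSup_of_le i.1 (by simp))
    (Eventually.of_forall fun N x hx => by
      obtain ⟨n, hn, c, hc, hxc⟩ := (frequently_atTop.1 (hE x hx)) N
      obtain ⟨k, rfl⟩ := Nat.exists_eq_add_of_le' hn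
      exact mem_iUnion.2 ⟨⟨k, ⟨c, hc⟩⟩, hxc⟩)
  refine dimH_le_of_hausdorffMeasure_ne_top (d := s) (ne_top_of_le_ne_top ENNReal.zero_ne_top
    (hbound.trans ?_))
  refine (le_of_eq ?_).trans hlim.liminf_eq.le
  congr 1
  ext N
  rw [ENNReal.tsum_sigma']
  refine tsum_congr fun n => ?_
  simp [Real.ediam_Icc, f]

/-- The left endpoints of the cylinders of level `n` meeting `[0, r)`, and their number. -/
theorem exists_finset_cylinder_endpoints {β : ℝ} (hβ : 1 < β) (n : ℕ) :
    ∀ r ∈ Icc (0 : ℝ) 1, ∃ S : Finset ℝ, (S.card : ℝ) ≤ r * n * β ^ n + 1 ∧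
      ∀ x ∈ Ico (0 : ℝ) r, x - (betaTransformation β)^[n] x / β ^ n ∈ S := by
  classical
  have hβ0 : 0 < β := by linarith
  induction n with
  | zero =>
    intro r hr
    exact ⟨{0}, by simp, by simp⟩
  | succ n ih =>
    intro r hr
    obtain ⟨S₁, hc₁, hS₁⟩ := ih 1 (by simp)
    obtain ⟨S₂, hc₂, hS₂⟩ := ih (Int.fract (β * r))
      ⟨Int.fract_nonneg _, (Int.fract_lt_one _).le⟩
    have hβr : 0 ≤ β * r := mul_nonneg hβ0.le hr.1
    -- Split by the first digit: a digit below `⌊βr⌋` leaves all of `[0,1)`, the digit `⌊βr⌋` leaves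
    -- `[0, fract (βr))`.
    refine ⟨(Finset.range ⌊β * r⌋₊ ×ˢ S₁).image (fun p : ℕ × ℝ => (p.1 + p.2) / β) ∪
      S₂.image (fun y => (⌊β * r⌋₊ + y) / β), ?_, ?_⟩
    · have h1 : (⌊β * r⌋₊ : ℝ) + Int.fract (β * r) = β * r := by
        rw [natCast_floor_eq_intCast_floor hβr]
        exact Int.floor_add_fract _
      have h2 : (((Finset.range ⌊β * r⌋₊ ×ˢ S₁).image (fun p : ℕ × ℝ => (p.1 + p.2) / β) ∪
          S₂.image (fun y : ℝ => (⌊β * r⌋₊ + y) / β)).card : ℝ) ≤ ⌊β * r⌋₊ * S₁.card + S₂.card := by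
        refine (Nat.cast_le.2 (Finset.card_union_le _ _)).trans ?_
        rw [Nat.cast_add]
        refine add_le_add ((Nat.cast_le.2 Finset.card_image_le).trans ?_)
          (Nat.cast_le.2 Finset.card_image_le)
        simp
      have h3 : (⌊β * r⌋₊ : ℝ) * S₁.card ≤ ⌊β * r⌋₊ * (1 * n * β ^ n + 1) := by gcongr
      have h4 : (⌊β * r⌋₊ : ℝ) ≤ β * r := Nat.floor_le hβr
      have h5 : r * β ≤ r * β ^ (n + 1) := by
        gcongr
        · exact hr.1
        · exact le_self_pow₀ hβ.le (by simp)
      -- The factor `r` lets the main terms add up to `βr · n β^n`; the additional ones contribute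
      -- `⌊βr⌋ ≤ r β^(n+1)`, which raises `n` to `n + 1`.
      calc _ ≤ (⌊β * r⌋₊ : ℝ) * (1 * n * β ^ n + 1) + (Int.fract (β * r) * n * β ^ n + 1) := by
            linarith
        _ = (⌊β * r⌋₊ + Int.fract (β * r)) * n * β ^ n + ⌊β * r⌋₊ + 1 := by ring
        _ ≤ β * r * n * β ^ n + r * β ^ (n + 1) + 1 := by rw [h1]; linarith
        _ = _ := by push_cast; ring
    · intro x hx
      have hβx : 0 ≤ β * x := mul_nonneg hβ0.le hx.1
      have hT : betaTransformation β x = β * x - ⌊β * x⌋₊ := by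
        rw [natCast_floor_eq_intCast_floor hβx, betaTransformation]
      have hTm := betaTransformation_mem_Ico β x
      have hx' : x - (betaTransformation β)^[n + 1] x / β ^ (n + 1) = (⌊β * x⌋₊ +
          (betaTransformation β x -
            (betaTransformation β)^[n] (betaTransformation β x) / β ^ n)) / β := by
        rw [Function.iterate_succ_apply, hT]
        field_simp
        ring
      have hlt : β * x < β * r := mul_lt_mul_of_pos_left hx.2 hβ0
      rw [hx', Finset.mem_union]
      rcases (Nat.floor_le_floor hlt.le).lt_or_eq with h | h
      · left
        exact Finset.mem_image.2 ⟨(_, _), Finset.mem_product.2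
          ⟨Finset.mem_range.2 h, hS₁ _ hTm⟩, rfl⟩
      · right
        rw [h]
        refine Finset.mem_image_of_mem _ (hS₂ _ ⟨hTm.1, ?_⟩)
        rw [hT, h, Int.fract, natCast_floor_eq_intCast_floor (hβx.trans hlt.le)]
        linarith

theorem dimH_longZeroRunSet_le {β : ℝ} (hβ : 1 < β) {φ : ℕ → ℝ} {a : ℝ} (ha : 0 ≤ a)
    (hφ : ∀ᶠ n : ℕ in atTop, a * n ≤ φ n) {s : NNReal} (hs : 1 < s * (1 + a)) :
    dimH (longZeroRunSet β φ) ≤ s := by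
  have hβ0 : 0 < β := by linarith
  choose S hcard hS using fun n => exists_finset_cylinder_endpoints hβ n 1 (by simp)
  have hr : Tendsto (fun n : ℕ => (β ^ (-(1 + a))) ^ n) atTop (𝓝 0) :=
    tendsto_pow_atTop_nhds_zero_of_lt_one (by positivity)
      (Real.rpow_lt_one_of_one_lt_of_neg hβ (by linarith))
  refine dimH_le_of_frequently_mem_Icc S (fun n => by positivity) hr ?_ ?_
  · have hq : β ^ (1 - s * (1 + a)) < 1 := Real.rpow_lt_one_of_one_lt_of_neg hβ (by linarith)
    have hq0 : 0 ≤ β ^ (1 - s * (1 + a)) := by positivity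
    have hsum : Summable fun n : ℕ => ((n : ℝ) ^ 1 * (β ^ (1 - s * (1 + a))) ^ n +
        (β ^ (1 - s * (1 + a))) ^ n) :=
      (summable_pow_mul_geometric_of_norm_lt_one 1 (by rwa [Real.norm_of_nonneg hq0])).add
        (summable_geometric_of_lt_one hq0 hq)
    refine hsum.of_nonneg_of_le (fun n => by positivity) fun n => ?_
    have h1 : ((β ^ (-(1 + a))) ^ n) ^ (s : ℝ) = (β ^ (-(s * (1 + a)))) ^ n := by
      simp only [← Real.rpow_natCast, ← Real.rpow_mul hβ0.le]
      ring_nf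
    have h2 : (β ^ (1 - s * (1 + a))) ^ n = β ^ n * (β ^ (-(s * (1 + a)))) ^ n := by
      rw [← mul_pow, sub_eq_add_neg, Real.rpow_add hβ0, Real.rpow_one]
    have h3 : (1 : ℝ) ≤ β ^ n := one_le_pow₀ hβ.le
    rw [h1, h2]
    calc _ ≤ (1 * n * β ^ n + 1) * (β ^ (-(s * (1 + a)))) ^ n := by gcongr; exact hcard n
      _ ≤ (n * β ^ n + β ^ n) * (β ^ (-(s * (1 + a)))) ^ n := by gcongr; linarith
      _ = _ := by ring
  · intro x hx
    obtain ⟨hx, hfr⟩ := (mem_longZeroRunSet_iff hβ).1 hx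
    refine (hfr.and_eventually hφ).mono ?_
    rintro n ⟨⟨k, hk, hlt⟩, hn⟩
    refine ⟨_, hS n x hx, ?_⟩
    have h0 := (iterate_betaTransformation_mem_Ico β hx n).1
    have h1 : (betaTransformation β)^[n] x ≤ β ^ (-(a * n)) := by
      have h2 : (betaTransformation β)^[n] x ≤ (β ^ k)⁻¹ := by
        rw [← one_div, le_div_iff₀' (by positivity)]
        exact hlt.le
      refine h2.trans ?_
      rw [Real.rpow_neg hβ0.le, ← Real.rpow_natCast]
      gcongr
      · exact hβ.le
      · linarith
    constructor
    · have : 0 ≤ (betaTransformation β)^[n] x / β ^ n := by positivity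
      linarith
    · have h3 : (β ^ (-(1 + a))) ^ n = β ^ (-(a * n)) / β ^ n := by
        rw [← Real.rpow_natCast, ← Real.rpow_natCast, ← Real.rpow_mul hβ0.le,
          ← Real.rpow_sub hβ0]
        ring_nf
      rw [h3]
      have : (betaTransformation β)^[n] x / β ^ n ≤ β ^ (-(a * n)) / β ^ n := by gcongr
      linarith

/-! ### Full cylinders -/

/-- The interval `[c, c + β⁻ⁿ)` is a full cylinder of level `n`: the map `T_β^n` sends it affinely
onto `[0, 1)`. -/
def IsFullCylinder (β : ℝ) (n : ℕ) (c : ℝ) : Prop :=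
  0 ≤ c ∧ c + 1 / β ^ n ≤ 1 ∧ ∀ t ∈ Ico (0 : ℝ) 1, (betaTransformation β)^[n] (c + t / β ^ n) = t

namespace IsFullCylinder

variable {β c d : ℝ} {n m : ℕ}

theorem zero (hβ : 1 < β) (n : ℕ) : IsFullCylinder β n 0 := by
  have h1 : (1 : ℝ) ≤ β ^ n := one_le_pow₀ hβ.le
  refine ⟨le_rfl, ?_, fun t ht => ?_⟩
  · rw [zero_add]
    exact div_le_one_of_le₀ h1 (by positivity)
  · have h2 : β ^ n * (t / β ^ n) = t := by field_simp
    have := ht.1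
    rw [zero_add, iterate_betaTransformation_eq_pow_mul hβ (by positivity) (by rw [h2]; exact ht.2),
      h2]

theorem append (hβ : 1 < β) (hc : IsFullCylinder β n c) (hd : IsFullCylinder β m d) :
    IsFullCylinder β (n + m) (c + d / β ^ n) := by
  have hβ0 : 0 < β := by linarith
  obtain ⟨hc0, hc1, hc⟩ := hc
  obtain ⟨hd0, hd1, hd⟩ := hd
  refine ⟨by positivity, ?_, fun t ht => ?_⟩
  · have h1 : c + d / β ^ n + 1 / β ^ (n + m) = c + (d + 1 / β ^ m) / β ^ n := by
      field_simp
      ring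
    rw [h1]
    refine le_trans ?_ hc1
    gcongr
  · have h1 : c + d / β ^ n + t / β ^ (n + m) = c + (d + t / β ^ m) / β ^ n := by
      field_simp
      ring
    have ht0 := ht.1
    have h2 : t / β ^ m < 1 / β ^ m := by
      gcongr
      exact ht.2
    rw [h1, add_comm n m, Function.iterate_add_apply,
      hc _ ⟨by positivity, by linarith⟩, hd t ht]

theorem cons (hβ : 1 < β) (hc : IsFullCylinder β n c) {k : ℕ} (h : k + c + 1 / β ^ n ≤ β) :
    IsFullCylinder β (n + 1) ((k + c) / β) := by
  have hβ0 : 0 < β := by linarith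
  obtain ⟨hc0, hc1, hc⟩ := hc
  refine ⟨by positivity, ?_, fun t ht => ?_⟩
  · have h1 : (k + c) / β + 1 / β ^ (n + 1) = (k + c + 1 / β ^ n) / β := by
      field_simp
      ring
    rw [h1]
    exact div_le_one_of_le₀ h hβ0.le
  · have h1 : (k + c) / β + t / β ^ (n + 1) = (((k : ℤ) : ℝ) + (c + t / β ^ n)) / β := by
      push_cast
      field_simp
      ring
    have ht0 := ht.1
    have h2 : t / β ^ n < 1 / β ^ n := by
      gcongr
      exact ht.2
    rw [h1, Function.iterate_succ_apply,
      betaTransformation_add_int_div hβ0.ne' ⟨by positivity, by linarith⟩, hc t ht]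

theorem iterate_eq (hβ : 1 < β) (hc : IsFullCylinder β n c) {x : ℝ}
    (hx : x ∈ Ico c (c + 1 / β ^ n)) :
    (betaTransformation β)^[n] x = (x - c) * β ^ n ∧ (x - c) * β ^ n ∈ Ico (0 : ℝ) 1 := by
  have hβ0 : 0 < β ^ n := by positivity
  have hmem : (x - c) * β ^ n ∈ Ico (0 : ℝ) 1 :=
    ⟨mul_nonneg (by linarith [hx.1]) hβ0.le, (lt_div_iff₀ hβ0).1 (by linarith [hx.2])⟩
  refine ⟨?_, hmem⟩
  have := hc.2.2 _ hmem
  rwa [mul_div_cancel_right₀ _ hβ0.ne', add_sub_cancel] at this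

/-- Here `[0, r)` is the image of the current cylinder and `y` the current orbit point. Either the
next digit already gives a full cylinder, or `r - y` is multiplied by `β`; as `r - y ≤ 1`, the
second case cannot recur forever. -/
theorem exists_mem_of_le (hβ : 1 < β) (n : ℕ) : ∀ r y : ℝ, 0 ≤ y → r ≤ 1 → 1 ≤ β ^ n * (r - y) →
    ∃ j c, 1 ≤ j ∧ IsFullCylinder β j c ∧ c + 1 / β ^ j ≤ r ∧ y ∈ Ico c (c + 1 / β ^ j) := by
  have hβ0 : 0 < β := by linarith
  have hβ1 : 1 / β < 1 := by rw [div_lt_one hβ0]; exact hβ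
  induction n with
  | zero =>
    intro r y hy hr h
    rw [pow_zero, one_mul] at h
    obtain rfl : y = 0 := by linarith
    obtain rfl : r = 1 := by linarith
    refine ⟨1, 0, le_rfl, zero hβ 1, ?_, le_rfl, ?_⟩
    · simpa using hβ1.le
    · simpa using hβ0
  | succ n ih =>
    intro r y hy hr h
    have hβy : 0 ≤ β * y := by positivity
    have hd := Nat.floor_le hβy
    have hd' := Nat.lt_floor_add_one (β * y)
    have hβr : β * r ≤ β := by nlinarith
    by_cases hcase : (⌊β * y⌋₊ : ℝ) + 1 ≤ β * r
    · have hf := cons (k := ⌊β * y⌋₊) hβ (zero hβ 0) (by simp; linarith)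
      refine ⟨_, _, le_add_self, hf, ?_, ?_, ?_⟩
      · rw [zero_add, pow_one, add_zero, ← add_div, div_le_iff₀' hβ0]
        exact hcase
      · rw [add_zero, div_le_iff₀' hβ0]
        exact hd
      · rw [zero_add, pow_one, add_zero, ← add_div, lt_div_iff₀' hβ0]
        exact hd'
    · obtain ⟨j, c, hj, hc, hcr, hyc⟩ := ih (β * r - ⌊β * y⌋₊) (β * y - ⌊β * y⌋₊) (by linarith)
        (by linarith) (by rw [pow_succ] at h; linarith)
      have hsucc : (⌊β * y⌋₊ + c) / β + 1 / β ^ (j + 1) = (⌊β * y⌋₊ + c + 1 / β ^ j) / β := by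
        field_simp
        ring
      refine ⟨_, _, le_add_self, cons (k := ⌊β * y⌋₊) hβ hc (by linarith), ?_, ?_, ?_⟩
      · rw [hsucc, div_le_iff₀' hβ0]
        linarith
      · rw [div_le_iff₀' hβ0]
        linarith [hyc.1]
      · rw [hsucc, lt_div_iff₀' hβ0]
        linarith [hyc.2]

/-- Apply the previous result along the orbit and concatenate. -/
theorem exists_mem (hβ : 1 < β) {x : ℝ} (hx : x ∈ Ico (0 : ℝ) 1) (N : ℕ) :
    ∃ n c, N ≤ n ∧ IsFullCylinder β n c ∧ x ∈ Ico c (c + 1 / β ^ n) := by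
  have step : ∀ y ∈ Ico (0 : ℝ) 1,
      ∃ j c, 1 ≤ j ∧ IsFullCylinder β j c ∧ y ∈ Ico c (c + 1 / β ^ j) := by
    intro y hy
    have hy1 : 0 < 1 - y := by linarith [hy.2]
    obtain ⟨n, hn⟩ := pow_unbounded_of_one_lt (1 / (1 - y)) hβ
    obtain ⟨j, c, hj, hc, -, hyc⟩ := exists_mem_of_le hβ n 1 y hy.1 le_rfl
      ((div_lt_iff₀ hy1).1 hn).le
    exact ⟨j, c, hj, hc, hyc⟩
  induction N with
  | zero =>
    obtain ⟨j, c, -, h⟩ := step x hx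
    exact ⟨j, c, zero_le, h⟩
  | succ N ih =>
    obtain ⟨n, c, hn, hc, hxc⟩ := ih
    obtain ⟨-, hmem⟩ := hc.iterate_eq hβ hxc
    obtain ⟨j, d, hj, hd, hyd⟩ := step _ hmem
    have hβ0 : 0 < β ^ n := by positivity
    refine ⟨n + j, _, by lia, hc.append hβ hd, ?_, ?_⟩
    · have := (div_le_iff₀ hβ0).2 hyd.1
      linarith
    · have h1 : c + d / β ^ n + 1 / β ^ (n + j) = c + (d + 1 / β ^ j) / β ^ n := by
        field_simp
        ring
      have := (lt_div_iff₀ hβ0).2 hyd.2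
      rw [h1]
      linarith

theorem finite_setOf (hβ : 1 < β) (n : ℕ) : {c | IsFullCylinder β n c}.Finite := by
  obtain ⟨S, -, hS⟩ := exists_finset_cylinder_endpoints hβ n 1 (by simp)
  refine S.finite_toSet.subset fun c hc => ?_
  have hβ0 : 0 < 1 / β ^ n := by positivity
  have h0 := hc.2.2 0 (by simp)
  have h1 := hS c ⟨hc.1, by linarith [hc.2.1]⟩
  rw [zero_div, add_zero] at h0
  simpa [h0] using h1

/-- For arbitrarily large `m` there are many full cylinders of level `m`. -/
theorem exists_le_card (hβ : 1 < β) {θ : ℝ} (hθ : θ < 1) :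
    ∃ (m : ℕ) (P : Finset ℝ), (∀ c ∈ P, IsFullCylinder β m c) ∧
      β ^ (θ * (m + 1)) ≤ (P.card : ℝ) := by
  have hβ0 : 0 < β := by linarith
  -- Otherwise the full cylinders of all levels have finite total length. Those of level at least
  -- `N` still cover `[0,1)`, yet their total length tends to `0`.
  by_contra! hcon
  let P : ℕ → Finset ℝ := fun n => (finite_setOf hβ n).toFinset
  have hP : ∀ {n c}, c ∈ P n ↔ IsFullCylinder β n c := by simp [P]
  have hlt : ∀ n, ((P n).card : ℝ) < β ^ (θ * (n + 1)) := fun n =>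
    hcon n (P n) fun c hc => hP.1 hc
  have hsum : Summable fun n => ((P n).card : ℝ) * (1 / β ^ n) := by
    have hq : β ^ (θ - 1) < 1 := Real.rpow_lt_one_of_one_lt_of_neg hβ (by linarith)
    refine ((summable_geometric_of_lt_one (by positivity) hq).mul_left (β ^ θ)).of_nonneg_of_le
      (fun n => by positivity) fun n => ?_
    have h1 : β ^ θ * (β ^ (θ - 1)) ^ n = β ^ (θ * (n + 1)) * (1 / β ^ n) := by
      rw [one_div, ← Real.rpow_natCast, ← Real.rpow_natCast, ← Real.rpow_mul hβ0.le,
        ← Real.rpow_neg hβ0.le, ← Real.rpow_add hβ0, ← Real.rpow_add hβ0]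
      ring_nf
    rw [h1]
    gcongr
    exact (hlt n).le
  have hlim := ENNReal.tendsto_sum_nat_add _ hsum.tsum_ofReal_ne_top
  obtain ⟨N, hN⟩ := (hlim.eventually_lt_const one_pos).exists
  refine hN.not_ge ?_
  have hcov : Ico (0 : ℝ) 1 ⊆ ⋃ n : ℕ, ⋃ c ∈ P (n + N), Ico c (c + 1 / β ^ (n + N)) := by
    intro x hx
    obtain ⟨n, c, hn, hc, hxc⟩ := exists_mem hβ hx N
    obtain ⟨k, rfl⟩ := Nat.exists_eq_add_of_le' hn
    exact mem_iUnion.2 ⟨k, mem_iUnion₂.2 ⟨c, hP.2 hc, hxc⟩⟩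
  calc (1 : ℝ≥0∞) = MeasureTheory.volume (Ico (0 : ℝ) 1) := by simp
    _ ≤ ∑' n : ℕ, MeasureTheory.volume (⋃ c ∈ P (n + N), Ico c (c + 1 / β ^ (n + N))) :=
      (MeasureTheory.measure_mono hcov).trans (MeasureTheory.measure_iUnion_le _)
    _ ≤ _ := by
      refine ENNReal.tsum_le_tsum fun n => (MeasureTheory.measure_biUnion_finset_le _ _).trans ?_
      rw [ENNReal.ofReal_mul (by positivity), ENNReal.ofReal_natCast]
      simp

end IsFullCylinder

/-! ### Density of the free positions -/

theorem Nat.count_add_of_forall {p : ℕ → Prop} [DecidablePred p] {u v : ℕ}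
    (huv : u ≤ v) (h : ∀ j, u ≤ j → j < v → p j) : Nat.count p v = Nat.count p u + (v - u) := by
  obtain ⟨k, rfl⟩ := Nat.exists_eq_add_of_le huv
  rw [Nat.count_add, Nat.add_sub_cancel_left,
    (Nat.count_iff_forall (n := k)).2 fun j hj => h _ (by lia) (by lia)]

theorem Nat.exists_lt_count_eq {p : ℕ → Prop} [DecidablePred p] {i n : ℕ}
    (h : i < Nat.count p n) : ∃ j < n, p j ∧ Nat.count p j = i := by
  induction n with
  | zero => simp at h
  | succ n ih =>
    by_cases hi : i < Nat.count p n
    · obtain ⟨j, hj, h⟩ := ih hi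
      exact ⟨j, by lia, h⟩
    · rw [Nat.count_succ] at h
      split_ifs at h with hp
      · exact ⟨n, by lia, hp, by lia⟩
      · exact absurd h hi

/-- The complement of a sequence of sparse windows `[a i, b i)` has lower density at least `σ`. -/
theorem le_count_compl_windows {a b : ℕ → ℕ} {σ : ℝ} (hσ0 : 0 ≤ σ) (hσ1 : σ ≤ 1)
    (hab : ∀ i, a i < b i) (h0 : σ * b 0 ≤ a 0) (h : ∀ i, b i + σ * b (i + 1) ≤ a (i + 1))
    [DecidablePred fun j => ∀ i, ¬(a i ≤ j ∧ j < b i)] (n : ℕ) :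
    σ * n ≤ Nat.count (fun j => ∀ i, ¬(a i ≤ j ∧ j < b i)) n := by
  have hba : ∀ i, b i ≤ a (i + 1) := fun i => by
    have h1 := h i
    have h2 : 0 ≤ σ * b (i + 1) := by positivity
    exact_mod_cast (by linarith : (b i : ℝ) ≤ a (i + 1))
  have ha : StrictMono a := strictMono_nat_of_lt_succ fun i => (hab i).trans_le (hba i)
  have hb : StrictMono b := strictMono_nat_of_lt_succ fun i => (hba i).trans_lt (hab (i + 1))
  -- A free stretch `[u, v)` followed by a window ending at `w`: the count grows at rate `1 ≥ σ` on
  -- the stretch, which alone holds `σ w` free positions and so pays for the window.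
  have key : ∀ (u v w n : ℕ), u ≤ v → (∀ j, u ≤ j → j < v → ∀ i, ¬(a i ≤ j ∧ j < b i)) →
      σ * u ≤ Nat.count (fun j => ∀ i, ¬(a i ≤ j ∧ j < b i)) u → u + σ * w ≤ v → n ≤ w → u ≤ n →
      σ * n ≤ Nat.count (fun j => ∀ i, ¬(a i ≤ j ∧ j < b i)) n := by
    intro u v w n huv hfree hu hw hnw hun
    rcases le_total n v with hnv | hvn
    · rw [Nat.count_add_of_forall hun fun j h1 h2 => hfree j h1 (by lia)]
      have hun' : (u : ℝ) ≤ n := by exact_mod_cast hun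
      push_cast [hun]
      nlinarith
    · have h1 := Nat.count_monotone (fun j => ∀ i, ¬(a i ≤ j ∧ j < b i)) hvn
      rw [Nat.count_add_of_forall huv hfree] at h1
      have h2 : ((v - u : ℕ) : ℝ) ≤ Nat.count (fun j => ∀ i, ¬(a i ≤ j ∧ j < b i)) n := by
        exact_mod_cast (le_add_self.trans h1)
      have h3 : σ * n ≤ σ * w := by gcongr
      push_cast [huv] at h2
      linarith
  have main : ∀ i, ∀ n ≤ b i, σ * n ≤ Nat.count (fun j => ∀ i, ¬(a i ≤ j ∧ j < b i)) n := by
    intro i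
    induction i with
    | zero =>
      intro n hn
      refine key 0 (a 0) (b 0) n zero_le (fun j _ hj i hi => ?_) (by simp) (by simpa using h0) hn
        zero_le
      have := ha.monotone (zero_le (a := i))
      lia
    | succ i ih =>
      intro n hn
      rcases le_total n (b i) with h1 | h1
      · exact ih n h1
      refine key (b i) (a (i + 1)) (b (i + 1)) n (hba i) (fun j hj1 hj2 k hk => ?_)
        (ih _ le_rfl) (h i) hn h1
      rcases le_or_gt k i with hki | hki
      · have := hb.monotone hki
        lia
      · have := ha.monotone (Nat.succ_le_of_lt hki)
        lia
  exact main n n hb.le_apply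

/-! ### Cantor sets of digit series -/

/-- The sum of the series `d₀ + d₁ q + d₂ q² + ⋯`. -/
noncomputable def digitSeries (q : ℝ) (d : ℕ → ℝ) : ℝ := ∑' j, d j * q ^ j

section digitSeries

variable {q κ : ℝ} {d d' : ℕ → ℝ}

theorem summable_digitSeries (hq0 : 0 < q) (hq1 : q < 1) (hκ : 0 ≤ κ)
    (hd : ∀ j, d j ∈ Icc 0 (1 - κ)) : Summable fun j => d j * q ^ j := by
  refine (summable_geometric_of_lt_one hq0.le hq1).of_nonneg_of_le
    (fun j => mul_nonneg (hd j).1 (by positivity)) fun j => ?_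
  exact mul_le_of_le_one_left (by positivity) (by linarith [(hd j).2])

theorem digitSeries_mem_Ico (hq0 : 0 < q) (hq1 : q < 1) (hκ : q < κ)
    (hd : ∀ j, d j ∈ Icc 0 (1 - κ)) : digitSeries q d ∈ Ico (0 : ℝ) 1 := by
  have hs := summable_digitSeries hq0 hq1 (hq0.trans hκ).le hd
  refine ⟨tsum_nonneg fun j => mul_nonneg (hd j).1 (by positivity), ?_⟩
  have h1 : digitSeries q d ≤ ∑' j, (1 - κ) * q ^ j :=
    hs.tsum_le_tsum (fun j => mul_le_mul_of_nonneg_right (hd j).2 (by positivity))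
      ((summable_geometric_of_lt_one hq0.le hq1).mul_left _)
  rw [tsum_mul_left, tsum_geometric_of_lt_one hq0.le hq1] at h1
  refine h1.trans_lt ?_
  rw [← div_eq_mul_inv, div_lt_one (by linarith)]
  linarith

theorem digitSeries_eq_sum_add (hq0 : 0 < q) (hq1 : q < 1) (hκ : 0 ≤ κ)
    (hd : ∀ j, d j ∈ Icc 0 (1 - κ)) (n : ℕ) :
    digitSeries q d =
      ∑ j ∈ Finset.range n, d j * q ^ j + q ^ n * digitSeries q fun j => d (j + n) := by
  rw [digitSeries, ← (summable_digitSeries hq0 hq1 hκ hd).sum_add_tsum_nat_add n, digitSeries,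
    ← tsum_mul_left]
  congr 2
  ext j
  ring

/-- At the first disagreement the digits differ by `κ`, while the tails lie in `[0,1)` and
compensate less than `q`. -/
theorem le_abs_digitSeries_sub (hq0 : 0 < q) (hq1 : q < 1) (hκ : q < κ)
    (hd : ∀ j, d j ∈ Icc 0 (1 - κ)) (hd' : ∀ j, d' j ∈ Icc 0 (1 - κ)) {n : ℕ}
    (heq : ∀ j < n, d j = d' j) (hne : κ ≤ |d n - d' n|) :
    q ^ n * (κ - q) ≤ |digitSeries q d - digitSeries q d'| := by
  have hκ0 := (hq0.trans hκ).le
  have hsum : ∑ j ∈ Finset.range n, d j * q ^ j = ∑ j ∈ Finset.range n, d' j * q ^ j :=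
    Finset.sum_congr rfl fun j hj => by rw [heq j (Finset.mem_range.1 hj)]
  rw [digitSeries_eq_sum_add hq0 hq1 hκ0 hd n, digitSeries_eq_sum_add hq0 hq1 hκ0 hd' n, hsum,
    add_sub_add_left_eq_sub, ← mul_sub, abs_mul, abs_of_pos (pow_pos hq0 n)]
  gcongr
  rw [digitSeries_eq_sum_add hq0 hq1 hκ0 (fun j => hd (j + n)) 1,
    digitSeries_eq_sum_add hq0 hq1 hκ0 (fun j => hd' (j + n)) 1]
  have h1 := digitSeries_mem_Ico hq0 hq1 hκ fun j => hd (j + 1 + n)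
  have h2 := digitSeries_mem_Ico hq0 hq1 hκ fun j => hd' (j + 1 + n)
  simp only [Finset.sum_range_one, pow_zero, mul_one, pow_one, zero_add]
  set A := digitSeries q fun j => d (j + 1 + n)
  set B := digitSeries q fun j => d' (j + 1 + n)
  have h3 : |q * (B - A)| ≤ q := by
    rw [abs_mul, abs_of_pos hq0]
    refine mul_le_of_le_one_right hq0.le ?_
    rw [abs_le]
    exact ⟨by linarith [h1.2, h2.1], by linarith [h1.1, h2.2]⟩
  have h4 := abs_sub_abs_le_abs_sub (d n - d' n) (q * (B - A))
  have h5 : d n + q * A - (d' n + q * B) = d n - d' n - q * (B - A) := by ring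
  rw [h5]
  linarith

/-- A lower bound for the dimension of a Cantor set whose digits are free at the positions
satisfying `p` and vanish at the other positions. -/
theorem le_dimH_range_digitSeries {M : ℕ} (hM : 1 < M) {s : NNReal} (hs : 0 < s)
    (hq0 : 0 < q) (hq1 : q < 1) (hκ : q < κ) {g : Fin M → ℝ} (hg : ∀ i, g i ∈ Icc 0 (1 - κ))
    (hgap : ∀ i j, i ≠ j → κ ≤ |g i - g j|) {p : ℕ → Prop} [DecidablePred p]
    (hcount : ∀ n, ((M : ℝ) ^ Nat.count p n)⁻¹ ≤ (q ^ n) ^ (s : ℝ)) :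
    s ≤ dimH (range fun e : ℕ → Fin M =>
      digitSeries q fun j => if p j then g (e (Nat.count p j)) else 0) := by
  set D : (ℕ → Fin M) → ℕ → ℝ := fun e j => if p j then g (e (Nat.count p j)) else 0 with hD
  have hs' : (0 : ℝ) < s := hs
  have hDmem : ∀ e j, D e j ∈ Icc 0 (1 - κ) := by
    intro e j
    simp only [hD]
    split_ifs
    · exact hg _
    · have := hg ⟨0, by lia⟩
      exact ⟨le_rfl, this.1.trans this.2⟩
  -- Agreement of `D` below `n` fixes the first `Nat.count p n` digits in base `M`.
  have hagree : ∀ e e' n, (∀ j < n, D e j = D e' j) →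
      |Real.ofDigits e - Real.ofDigits e'| ≤ (q ^ n) ^ (s : ℝ) := by
    intro e e' n h
    refine (Real.abs_ofDigits_sub_ofDigits_le fun i hi => ?_).trans (hcount n)
    obtain ⟨j, hj, hpj, rfl⟩ := Nat.exists_lt_count_eq hi
    by_contra hne
    have h1 := h j hj
    simp only [hD, hpj, if_true] at h1
    have h2 := hgap _ _ hne
    rw [h1, sub_self, abs_zero] at h2
    linarith
  have hκq : 0 < κ - q := by linarith
  have hholder : ∀ e e', |Real.ofDigits e - Real.ofDigits e'| ≤
      ((κ - q)⁻¹) ^ (s : ℝ) * |digitSeries q (D e) - digitSeries q (D e')| ^ (s : ℝ) := by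
    intro e e'
    by_cases h : ∀ j, D e j = D e' j
    · have hlim : Tendsto (fun n : ℕ => (q ^ n) ^ (s : ℝ)) atTop (𝓝 0) := by
        have h1 := (tendsto_pow_atTop_nhds_zero_of_lt_one hq0.le hq1).rpow_const
          (p := (s : ℝ)) (Or.inr hs'.le)
        rwa [Real.zero_rpow hs'.ne'] at h1
      have h0 := ge_of_tendsto' hlim fun n => hagree e e' n fun j _ => h j
      exact h0.trans (by positivity)
    · push Not at h
      classical
      have hn := Nat.find_spec h
      have hlt : ∀ j < Nat.find h, D e j = D e' j := fun j hj => not_not.1 (Nat.find_min h hj)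
      set n := Nat.find h
      refine (hagree e e' n hlt).trans ?_
      have hgapn : κ ≤ |D e n - D e' n| := by
        simp only [hD] at hn ⊢
        split_ifs at hn ⊢ with hp
        · exact hgap _ _ fun h => hn (by rw [h])
        · exact absurd rfl hn
      have := le_abs_digitSeries_sub hq0 hq1 hκ (hDmem e) (hDmem e') hlt hgapn
      rw [← Real.mul_rpow (by positivity) (by positivity)]
      gcongr
      rw [inv_mul_eq_div, le_div_iff₀ hκq]
      exact this
  set X : (ℕ → Fin M) → ℝ := fun e => digitSeries q (D e)
  have : Nonempty (Fin M) := ⟨⟨0, by lia⟩⟩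
  -- Any preimage will do: by `hholder`, `Real.ofDigits e` depends only on the point `X e`.
  choose! f hf using fun x (hx : x ∈ range X) => hx
  have hfX : ∀ e, Real.ofDigits (f (X e)) = Real.ofDigits e := by
    intro e
    have h1 := hholder (f (X e)) e
    have h2 : digitSeries q (D (f (X e))) = digitSeries q (D e) := hf _ ⟨e, rfl⟩
    rw [h2, sub_self, abs_zero, Real.zero_rpow hs'.ne', mul_zero] at h1
    exact sub_eq_zero.1 (abs_nonpos_iff.1 h1)
  let C : NNReal := ⟨((κ - q)⁻¹) ^ (s : ℝ), by positivity⟩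
  have hH : HolderOnWith C s (fun x => Real.ofDigits (f x)) (range X) := by
    rintro _ ⟨e, rfl⟩ _ ⟨e', rfl⟩
    dsimp only
    rw [hfX, hfX, edist_dist, edist_dist, ENNReal.ofReal_rpow_of_nonneg dist_nonneg s.coe_nonneg,
      ← ENNReal.ofReal_coe_nnreal, ← ENNReal.ofReal_mul C.coe_nonneg]
    exact ENNReal.ofReal_le_ofReal (hholder e e')
  have hdim := hH.dimH_image_le hs
  have hIcc : Icc (0 : ℝ) 1 ⊆ (fun x => Real.ofDigits (f x)) '' range X := by
    intro y hy
    obtain ⟨e, -, rfl⟩ := Real.ofDigits_SurjOn hM hy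
    exact ⟨X e, ⟨e, rfl⟩, hfX e⟩
  have hone : dimH (Icc (0 : ℝ) 1) = 1 := by
    rw [Real.dimH_of_nonempty_interior]
    · simp
    · rw [interior_Icc]
      exact nonempty_Ioo.2 one_pos
  have h1 := hone.symm.le.trans ((dimH_mono hIcc).trans hdim)
  rwa [ENNReal.le_div_iff_mul_le (Or.inl (by simpa using hs.ne')) (Or.inl ENNReal.coe_ne_top),
    one_mul] at h1

end digitSeries

/-! ### Lower bound: the Cantor subset -/

namespace IsFullCylinder

variable {β c d : ℝ} {n m : ℕ}

/-- If `d` were in the cylinder of `c`, `T^n d` would be both `(d - c) β^n > 0` and `0`. -/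
theorem le_abs_sub (hβ : 1 < β) (hc : IsFullCylinder β n c) (hd : IsFullCylinder β n d)
    (hcd : c ≠ d) : 1 / β ^ n ≤ |c - d| := by
  wlog h : c < d generalizing c d
  · rw [abs_sub_comm]
    exact this hd hc hcd.symm (lt_of_le_of_ne (not_lt.1 h) hcd.symm)
  rw [abs_sub_comm, abs_of_pos (by linarith)]
  by_contra! hlt
  have h1 := (hc.iterate_eq hβ (x := d) ⟨h.le, by linarith⟩).1
  have hβ0 : 0 < β ^ n := by positivity
  have h2 := (hd.iterate_eq hβ (x := d) ⟨le_rfl, by linarith [show 0 < 1 / β ^ n by positivity]⟩).1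
  rw [h2, sub_self, zero_mul] at h1
  have : 0 < (d - c) * β ^ n := mul_pos (by linarith) hβ0
  linarith

end IsFullCylinder

theorem iterate_betaTransformation_digitSeries {β : ℝ} (hβ : 1 < β) {ℓ : ℕ} {κ : ℝ}
    (hℓ : 1 ≤ ℓ) (hκ : 1 / β ^ ℓ < κ) {d : ℕ → ℝ} (hd : ∀ j, d j ∈ Icc 0 (1 - κ))
    (hfull : ∀ j, IsFullCylinder β ℓ (d j)) (n : ℕ) :
    (betaTransformation β)^[ℓ * n] (digitSeries (1 / β ^ ℓ) d) =
      digitSeries (1 / β ^ ℓ) fun j => d (j + n) := by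
  have hq0 : 0 < 1 / β ^ ℓ := by positivity
  have hq1 : 1 / β ^ ℓ < 1 := by
    rw [div_lt_one (by positivity)]
    exact one_lt_pow₀ hβ (by lia)
  induction n with
  | zero => simp
  | succ n ih =>
    rw [mul_add, mul_one, add_comm, Function.iterate_add_apply, ih,
      digitSeries_eq_sum_add hq0 hq1 (hq0.trans hκ).le (fun j => hd (j + n)) 1]
    have h := (hfull n).2.2 _ (digitSeries_mem_Ico hq0 hq1 hκ fun j => hd (j + 1 + n))
    convert h using 2
    · simp [div_eq_inv_mul]
    · ext j
      ring_nf

/-- Long zero blocks in the digits of level `ℓ` produce long runs of zeros. -/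
theorem mem_longZeroRunSet_of_windows {β : ℝ} (hβ : 1 < β) {φ : ℕ → ℝ} {ℓ : ℕ} {κ : ℝ}
    (hℓ : 1 ≤ ℓ) (hκ : 1 / β ^ ℓ < κ) {d : ℕ → ℝ} (hd : ∀ j, d j ∈ Icc 0 (1 - κ))
    (hfull : ∀ j, IsFullCylinder β ℓ (d j))
    (hfr : ∃ᶠ n : ℕ in atTop, ∃ k b : ℕ, φ n ≤ k ∧ n + k ≤ ℓ * b ∧
      ∀ j, n / ℓ ≤ j → j < b → d j = 0) :
    digitSeries (1 / β ^ ℓ) d ∈ longZeroRunSet β φ := by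
  have hq0 : 0 < 1 / β ^ ℓ := by positivity
  have hq1 : 1 / β ^ ℓ < 1 := by
    rw [div_lt_one (by positivity)]
    exact one_lt_pow₀ hβ (by lia)
  refine (mem_longZeroRunSet_iff hβ).2 ⟨digitSeries_mem_Ico hq0 hq1 hκ hd, hfr.mono ?_⟩
  rintro n ⟨k, b, hk, hb, hzero⟩
  refine ⟨k, hk, ?_⟩
  have hn := Nat.div_add_mod n ℓ
  set a := n / ℓ
  set r := n % ℓ
  have hab : a ≤ b := by
    by_contra! hlt
    have := Nat.mul_lt_mul_of_pos_left hlt hℓ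
    lia
  obtain ⟨c, rfl⟩ := Nat.exists_eq_add_of_le hab
  set y := digitSeries (1 / β ^ ℓ) fun j => d (j + a)
  have hy := digitSeries_mem_Ico hq0 hq1 hκ fun j => hd (j + a)
  have hylt : β ^ (ℓ * c) * y < 1 := by
    have h1 := digitSeries_eq_sum_add hq0 hq1 (hq0.trans hκ).le (fun j => hd (j + a)) c
    rw [Finset.sum_eq_zero fun j hj => by
      rw [hzero (j + a) (by lia) (by have := Finset.mem_range.1 hj; lia), zero_mul], zero_add] at h1
    have h2 := digitSeries_mem_Ico hq0 hq1 hκ fun j => hd (j + c + a)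
    have h3 : β ^ (ℓ * c) * ((1 / β ^ ℓ) ^ c * digitSeries (1 / β ^ ℓ) fun j => d (j + c + a)) =
        digitSeries (1 / β ^ ℓ) fun j => d (j + c + a) := by
      rw [pow_mul, ← mul_assoc, ← mul_pow, mul_one_div_cancel (by positivity), one_pow, one_mul]
    rw [show y = _ from h1, h3]
    exact h2.2
  -- The window starts at the block containing position `n = ℓ a + r`, so `k + r` zeros are needed
  -- from `ℓ a` on.
  have hle : β ^ (k + r) * y < 1 := by
    refine lt_of_le_of_lt ?_ hylt
    have : k + r ≤ ℓ * c := by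
      rw [mul_add] at hb
      lia
    exact mul_le_mul_of_nonneg_right (pow_le_pow_right₀ hβ.le this) hy.1
  have hle' : β ^ r * y < 1 := by
    refine lt_of_le_of_lt ?_ hle
    exact mul_le_mul_of_nonneg_right (pow_le_pow_right₀ hβ.le (by lia)) hy.1
  rw [← hn, add_comm, Function.iterate_add_apply,
    iterate_betaTransformation_digitSeries hβ hℓ hκ hd hfull,
    iterate_betaTransformation_eq_pow_mul hβ hy.1 hle', ← mul_assoc, ← pow_add]
  exact hle

/-- A window starting near `n / ℓ` ends near `(1 + a) n / ℓ`. Since `σ (1 + a) < 1`, a large enough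
`n` leaves room for any earlier `b i`. -/
theorem exists_sparse_windows {a σ : ℝ} (ha : 0 ≤ a) (hσ0 : 0 ≤ σ) (hσ : σ * (1 + a) < 1) {ℓ : ℕ}
    (hℓ : 1 ≤ ℓ) {Q : ℕ → Prop} (hQ : ∃ᶠ n in atTop, Q n) :
    ∃ N : ℕ → ℕ, ∃ b : ℕ → ℕ, (∀ i, Q (N i)) ∧ (∀ i, N i + ⌈a * N i⌉₊ ≤ ℓ * b i) ∧
      (∀ i, N i / ℓ < b i) ∧ σ * b 0 ≤ (N 0 / ℓ : ℕ) ∧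
      ∀ i, b i + σ * b (i + 1) ≤ (N (i + 1) / ℓ : ℕ) := by
  have hℓ0 : (0 : ℝ) < ℓ := by exact_mod_cast hℓ
  let B : ℕ → ℕ := fun n => (n + ⌈a * n⌉₊) / ℓ + 1
  have hev : ∀ K : ℕ, ∀ᶠ n : ℕ in atTop, K + σ * B n ≤ (n / ℓ : ℕ) := by
    intro K
    have h1 : Tendsto (fun n : ℕ => (1 - σ * (1 + a)) / ℓ * (n : ℝ)) atTop atTop :=
      tendsto_natCast_atTop_atTop.const_mul_atTop (div_pos (by linarith) hℓ0)
    -- `σ * (1 / ℓ + 1)` absorbs the rounding in `B n`, and the last `1` that of `n / ℓ`.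
    filter_upwards [h1.eventually_ge_atTop (K + σ * (1 / ℓ + 1) + 1)] with n hn
    have h2 : (n : ℝ) / ℓ < (n / ℓ : ℕ) + 1 := by
      rw [div_lt_iff₀ hℓ0]
      exact_mod_cast Nat.lt_mul_of_div_lt (Nat.lt_succ_self _) hℓ
    have h3 : (B n : ℝ) ≤ (n + (a * n + 1)) / ℓ + 1 := by
      simp only [B]
      push_cast
      gcongr
      refine Nat.cast_div_le.trans ?_
      push_cast
      gcongr
      exact (Nat.ceil_lt_add_one (by positivity)).le
    have h4 : σ * B n ≤ σ * ((n + (a * n + 1)) / ℓ + 1) := by gcongr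
    have h5 : (1 - σ * (1 + a)) / ℓ * (n : ℝ) =
      n / ℓ - (σ * ((n + (a * n + 1)) / ℓ + 1) - σ * (1 / ℓ + 1)) := by
      field_simp
      ring
    linarith
  choose F hF using fun K => (hQ.and_eventually (hev K)).exists
  let N : ℕ → ℕ := fun i => Nat.rec (F 0) (fun _ n => F (B n)) i
  refine ⟨N, fun i => B (N i), fun i => ?_, fun i => ?_, fun i => ?_, ?_, fun i => ?_⟩
  · cases i with
    | zero => exact (hF 0).1
    | succ i => exact (hF _).1
  · exact (Nat.lt_mul_of_div_lt (Nat.lt_succ_self _) hℓ).le.trans_eq (mul_comm _ _)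
  · exact Nat.lt_succ_of_le (Nat.div_le_div_right le_self_add)
  · have h0 := (hF 0).2
    rwa [Nat.cast_zero, zero_add] at h0
  · exact (hF (B (N i))).2

theorem le_dimH_longZeroRunSet {β : ℝ} (hβ : 1 < β) {φ : ℕ → ℝ} {a : ℝ} (ha : 0 ≤ a)
    (hφ : ∃ᶠ n : ℕ in atTop, φ n ≤ a * n) {s : NNReal} (hs0 : 0 < s) (hs : s * (1 + a) < 1) :
    s ≤ dimH (longZeroRunSet β φ) := by
  classical
  have hβ0 : 0 < β := by linarith
  have hs0' : (0 : ℝ) < s := hs0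
  -- Factor `s = (s / σ) * σ`: `σ` is the density of free blocks, and `θ = s / σ < 1` the exponent
  -- in the number of blocks.
  obtain ⟨σ, hsσ, hσ'⟩ := exists_between ((lt_div_iff₀ (by linarith)).2 hs)
  have hσ := (lt_div_iff₀ (by linarith)).1 hσ'
  have hσ0 : 0 < σ := hs0'.trans hsσ
  have hσ1 : σ ≤ 1 := by nlinarith
  obtain ⟨m, P, hP, hcard⟩ := IsFullCylinder.exists_le_card hβ ((div_lt_one hσ0).2 hsσ)
  obtain ⟨N, b, hQ, hNb, hlt, h0, hstep⟩ :=
    exists_sparse_windows ha hσ0.le hσ (show 1 ≤ m + 1 by lia) hφ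
  have hba : ∀ i, b i ≤ N (i + 1) / (m + 1) := fun i => by
    have h1 := hstep i
    have h2 : 0 ≤ σ * b (i + 1) := by positivity
    exact_mod_cast (by linarith : (b i : ℝ) ≤ (N (i + 1) / (m + 1) : ℕ))
  have hmono : StrictMono fun i => N i / (m + 1) :=
    strictMono_nat_of_lt_succ fun i => (hlt i).trans_le (hba i)
  have hM : 1 < P.card := by
    have h1 : 1 < β ^ ((s : ℝ) / σ * (m + 1)) := Real.one_lt_rpow hβ (by positivity)
    exact_mod_cast h1.trans_le hcard
  have hq0 : 0 < 1 / β ^ (m + 1) := by positivity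
  have hq1 : 1 / β ^ (m + 1) < 1 := by
    rw [div_lt_one (by positivity)]
    exact one_lt_pow₀ hβ (by lia)
  -- The zero appended to each block makes the ratio `q = β^(-(m+1))` strictly smaller than the
  -- separation `κ = β^(-m)`.
  have hκ : 1 / β ^ (m + 1) < 1 / β ^ m := by
    gcongr
    lia
  have hκ1 : 1 / β ^ m ≤ 1 := div_le_one_of_le₀ (one_le_pow₀ hβ.le) (by positivity)
  let g : Fin P.card → ℝ := fun i => P.equivFin.symm i
  have hg : ∀ i, IsFullCylinder β m (g i) := fun i => hP _ (P.equivFin.symm i).2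
  have hgmem : ∀ i, g i ∈ Icc 0 (1 - 1 / β ^ m) := fun i =>
    ⟨(hg i).1, by linarith [(hg i).2.1]⟩
  have hgfull : ∀ i, IsFullCylinder β (m + 1) (g i) := fun i => by
    simpa using (hg i).append hβ (IsFullCylinder.zero hβ 1)
  have hgap : ∀ i j, i ≠ j → 1 / β ^ m ≤ |g i - g j| := fun i j hij =>
    (hg i).le_abs_sub hβ (hg j) fun h => hij (P.equivFin.symm.injective (Subtype.ext h))
  refine (le_dimH_range_digitSeries (g := g)
    (p := fun j => ∀ i, ¬(N i / (m + 1) ≤ j ∧ j < b i)) hM hs0 hq0 hq1 hκ hgmem hgap ?_).trans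
    (dimH_mono ?_)
  · intro n
    have hc := le_count_compl_windows hσ0.le hσ1 hlt h0 hstep n
    set C := Nat.count (fun j => ∀ i, ¬(N i / (m + 1) ≤ j ∧ j < b i)) n
    have h1 : β ^ ((s : ℝ) * ((m + 1) * n)) ≤ (P.card : ℝ) ^ C := by
      calc β ^ ((s : ℝ) * ((m + 1) * n)) = β ^ ((s : ℝ) / σ * (m + 1) * (σ * n)) := by
            congr 1
            field_simp
        _ ≤ β ^ ((s : ℝ) / σ * (m + 1) * C) := by
            gcongr
            exact hβ.le
        _ = (β ^ ((s : ℝ) / σ * (m + 1))) ^ C := by rw [Real.rpow_mul hβ0.le, Real.rpow_natCast]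
        _ ≤ _ := by gcongr
    have h2 : ((1 / β ^ (m + 1)) ^ n) ^ (s : ℝ) = (β ^ ((s : ℝ) * ((m + 1) * n)))⁻¹ := by
      rw [one_div, inv_pow, Real.inv_rpow (by positivity), ← pow_mul, ← Real.rpow_natCast,
        ← Real.rpow_mul hβ0.le]
      push_cast
      ring_nf
    rw [h2]
    gcongr
  · rintro _ ⟨e, rfl⟩
    refine mem_longZeroRunSet_of_windows hβ (by lia) hκ (fun j => ?_) (fun j => ?_) ?_
    · split_ifs
      · exact hgmem _
      · exact ⟨le_rfl, by linarith⟩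
    · split_ifs
      · exact hgfull _
      · exact IsFullCylinder.zero hβ _
    · rw [frequently_atTop]
      intro K
      refine ⟨N K, (hmono.le_apply (x := K)).trans (Nat.div_le_self _ _), ⌈a * N K⌉₊, b K,
        (hQ K).trans (Nat.le_ceil _), hNb K, fun j h1 h2 => ?_⟩
      exact if_neg fun h => h K ⟨h1, h2⟩

/-! ### The dimension formula -/

theorem mainTheorem7 (β : ℝ) (hβ : 1 < β) (φ : ℕ → ℝ) (hφ : ∀ n : ℕ, 1 ≤ n → 0 ≤ φ n) :
    dimH (longZeroRunSet β φ) =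
      1 / (1 + liminf (fun n : ℕ => ENNReal.ofReal (φ n / (n : ℝ))) atTop) := by
  set α := liminf (fun n : ℕ => ENNReal.ofReal (φ n / (n : ℝ))) atTop
  have hpos : ∀ᶠ n : ℕ in atTop, 0 < (n : ℝ) ∧ 0 ≤ φ n / n := by
    filter_upwards [eventually_ge_atTop 1] with n hn
    have h1 := hφ n hn
    exact ⟨by exact_mod_cast hn, by positivity⟩
  rw [one_div]
  apply le_antisymm
  · refine le_of_forall_gt_imp_ge_of_dense fun t ht => ?_
    obtain ⟨s, hs, hst⟩ := ENNReal.lt_iff_exists_nnreal_btwn.1 ht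
    refine le_trans ?_ hst.le
    rcases le_or_gt 1 s with h1 | h1
    · exact ((dimH_mono (subset_univ _)).trans Real.dimH_univ.le).trans (by exact_mod_cast h1)
    have hs0 : 0 < s := by
      rw [← ENNReal.coe_pos]
      exact pos_of_gt hs
    -- Writing `s⁻¹ = 1 + u` reduces the claim to comparing `u` with `α`, so `α = ∞` needs no
    -- separate treatment.
    obtain ⟨u, hu⟩ := exists_add_of_le (one_le_inv_iff₀.2 ⟨hs0, h1.le⟩)
    have huα : (u : ℝ≥0∞) < α := by
      have h2 : (1 + α)⁻¹ < ((s⁻¹ : NNReal) : ℝ≥0∞)⁻¹ := by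
        rwa [ENNReal.coe_inv hs0.ne', inv_inv]
      rw [ENNReal.inv_lt_inv, hu, ENNReal.coe_add, ENNReal.coe_one] at h2
      exact lt_of_add_lt_add_left h2
    obtain ⟨a, hua, haα⟩ := ENNReal.lt_iff_exists_nnreal_btwn.1 huα
    refine dimH_longZeroRunSet_le hβ a.coe_nonneg ?_ ?_
    · filter_upwards [eventually_lt_of_lt_liminf haα, hpos] with n hn hn0
      rw [← ENNReal.ofReal_coe_nnreal, ENNReal.ofReal_lt_ofReal_iff'] at hn
      exact ((lt_div_iff₀ hn0.1).1 hn.1).le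
    · have h3 : s⁻¹ < 1 + a := by
        rw [hu]
        gcongr
        exact_mod_cast hua
      exact_mod_cast (inv_lt_iff_one_lt_mul₀' hs0).1 h3
  · refine ENNReal.le_of_forall_nnreal_lt fun s hs => ?_
    rcases eq_zero_or_pos s with rfl | hs0
    · simp
    have h2 : 1 + α < ((s⁻¹ : NNReal) : ℝ≥0∞) := by
      rw [← ENNReal.inv_lt_inv, ENNReal.coe_inv hs0.ne', inv_inv]
      exact hs
    have h1 : 1 ≤ s⁻¹ := by exact_mod_cast (le_self_add.trans h2.le : (1 : ℝ≥0∞) ≤ (s⁻¹ : NNReal))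
    obtain ⟨u, hu⟩ := exists_add_of_le h1
    rw [hu, ENNReal.coe_add, ENNReal.coe_one] at h2
    obtain ⟨a, hαa, hau⟩ := ENNReal.lt_iff_exists_nnreal_btwn.1 (lt_of_add_lt_add_left h2)
    refine le_dimH_longZeroRunSet hβ a.coe_nonneg ?_ hs0 ?_
    · refine ((frequently_lt_of_liminf_lt (by isBoundedDefault) hαa).and_eventually hpos).mono ?_
      rintro n ⟨hn, hn0⟩
      rw [← ENNReal.ofReal_coe_nnreal, ENNReal.ofReal_lt_ofReal_iff'] at hn
      exact ((div_lt_iff₀ hn0.1).1 hn.1).le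
    · have h3 : 1 + a < s⁻¹ := by
        rw [hu]
        gcongr
        exact_mod_cast hau
      have h4 : s * (1 + a) < s * s⁻¹ := by gcongr
      rw [mul_inv_cancel₀ hs0.ne'] at h4
      exact_mod_cast h4
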